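/- Let $l\ge 1$, let $I=[a,b]\subset\mathbb R$ be a compact interval and let $f:I\to I$ be a continuous $l$-modal map: there are points $c_1<\dots<c_l$ in $(a,b)$ at which $f$ has local extrema, and $f$ is strictly monotone on each of $I_1=[a,c_1)$, $I_2=(c_1,c_2)$, …, $I_l=(c_{l-1},c_l)$, $I_{l+1}=(c_l,b]$. (The point $c_1$ may be a maximum or a minimum, and nothing is assumed on $f(a)$ and $f(b)$.) For $n\ge1$ and $1\le i\le l$ let $\gamma_n^i\in\{I_1,c_1,I_2,\dots,c_l,I_{l+1}\}$ be the symbol of the element of this list that contains, or equals, $f^n(c_i)$, and let the min-max symbol $\omega_n^i$ be $m^{\gamma_n^i}$ if $f^n$ has a local minimum at $c_i$, and $M^{\gamma_n^i}$ if $f^n$ has a local maximum at $c_i$ (exactly one of the two holds). The set of bad symbols with respect to the line $y=c_i$ is $$\mathcal B^i=\{M^{I_1},M^{c_1},\dots,M^{I_i},M^{c_i},\,m^{c_i},m^{I_{i+1}},\dots,m^{c_l},m^{I_{l+1}}\}.$$ For $\nu\ge0$ let $s_\nu^i$ be the number of $x\in(a,b)$ with $f^\nu(x)=c_i$ and $f^\mu(x)\ne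 c_i$ for $0\le\mu<\nu$ at which the graph of $f^\nu$ crosses the line $y=c_i$ transversally, that is, from one side of the line to the other (so $s_0^i=1$). Put $$K_\nu^i=\{(k,\kappa):1\le k\le l,\ 1\le\kappa\le\nu,\ \omega_\kappa^k\in\mathcal B^i\},\qquad S_\nu^i=2\sum_{(k,\kappa)\in K_\nu^i}s_{\nu-\kappa}^k,\qquad s_\nu=\sum_{i=1}^l s_\nu^i,\qquad S_\nu=\sum_{i=1}^l S_\nu^i .$$ Then, with the convention $\log 0=0$ for those $\nu$ with $s_\nu+S_\nu=0$, the topological entropy $h(f)$ is $$h(f)=\lim_{\nu\to\infty}\frac1\nu\log\frac{s_\nu+S_\nu}{l}=\lim_{\nu\to\infty}\frac1\nu\log\frac1l\sum_{i=1}^l\Bigl(s_\nu^i+2\sum_{(k,\kappa)\in K_\nu^i}s_{\nu-\kappa}^k\Bigr).$$ -/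

import Mathlib

open Filter Topology Set

/-- The `j`-th lap interval (`j = 0, …, l`, i.e. `I_{j+1}`) cut out of `[a, b]` by the points
`c 0 < … < c (l - 1)`: the points above `c k` for all `k < j` and below `c k` for all `k ≥ j`.
The first one contains `a` and the last one contains `b`. -/
def lapInterval {a b : ℝ} {l : ℕ} (c : Fin l → Icc a b) (j : Fin (l + 1)) : Set (Icc a b) :=
  {x | ∀ k : Fin l, (k.castSucc < j → c k < x) ∧ (j ≤ k.castSucc → x < c k)}

/-- `f` is an `l`-modal selfmap of `[a, b]` (of either shape) with turning points
`c 0 < … < c (l - 1)`. -/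
structure IsMultimodal {a b : ℝ} {l : ℕ} (f : Icc a b → Icc a b) (c : Fin l → Icc a b) :
    Prop where
  continuous : Continuous f
  strictMono : StrictMono c
  mem_Ioo : ∀ i, (c i : ℝ) ∈ Ioo a b
  isLocalExtr : ∀ i, IsLocalExtr f (c i)
  strict_on_lap : ∀ j, StrictMonoOn f (lapInterval c j) ∨ StrictAntiOn f (lapInterval c j)

/-- The alphabet `{I_1, c_1, I_2, …, c_l, I_{l+1}}` of kneading symbols
(with indices starting at `0`). -/
inductive KneadingSymbol (l : ℕ) : Type
  | lap (j : Fin (l + 1))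
  | crit (k : Fin l)

/-- The base of a min-max symbol: `m` for a minimum, `M` for a maximum. -/
inductive Extremum : Type
  | m
  | M

/-- A min-max symbol: a base in `{m, M}` with a kneading symbol as exponent. -/
structure MinMaxSymbol (l : ℕ) : Type where
  base : Extremum
  exponent : KneadingSymbol l

open Classical in
/-- The number of turning points below `x`; this is the index of the lap interval of `x` if `x`
is not a turning point. -/
noncomputable def lapIndex {a b : ℝ} {l : ℕ} (c : Fin l → Icc a b) (x : Icc a b) : Fin (l + 1) :=
  ⟨(Finset.univ.filter fun k => c k < x).card,
    Nat.lt_succ_of_le ((Finset.card_filter_le _ _).trans (by simp))⟩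

open Classical in
/-- The address of `x`: `c k` if `x = c k`, and otherwise the lap interval that contains `x`. -/
noncomputable def kneadingSymbol {a b : ℝ} {l : ℕ} (c : Fin l → Icc a b) (x : Icc a b) :
    KneadingSymbol l :=
  if h : ∃ k, x = c k then .crit h.choose else .lap (lapIndex c x)

theorem mem_lapInterval_lapIndex {a b : ℝ} {l : ℕ} {c : Fin l → Icc a b} (hc : StrictMono c)
    {x : Icc a b} (hx : ¬ ∃ k, x = c k) : x ∈ lapInterval c (lapIndex c x) := by
  classical
  intro k
  have key : c k < x ↔ k.val < (Finset.univ.filter fun k => c k < x).card := by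
    constructor
    · intro h
      have hsub : Finset.Iic k ⊆ Finset.univ.filter fun k => c k < x := by
        intro i hi
        simp only [Finset.mem_Iic] at hi
        simpa using (hc.monotone hi).trans_lt h
      have := Finset.card_le_card hsub
      rw [Fin.card_Iic] at this
      omega
    · intro h
      by_contra hk
      have hsub : (Finset.univ.filter fun k => c k < x) ⊆ Finset.Iio k := by
        intro i hi
        simp only [Finset.mem_filter, Finset.mem_univ, true_and] at hi
        simp only [Finset.mem_Iio]
        by_contra hik
        exact hk ((hc.monotone (not_lt.mp hik)).trans_lt hi)
      have := Finset.card_le_card hsub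
      rw [Fin.card_Iio] at this
      omega
  constructor
  · intro h
    exact key.2 (by simpa [lapIndex, Fin.lt_def] using h)
  · intro h
    have h' : ¬ c k < x := fun hk => by
      have h1 := key.1 hk
      have h2 : (Finset.univ.filter fun k => c k < x).card ≤ k.val := by
        simpa [lapIndex, Fin.le_def] using h
      omega
    exact lt_of_le_of_ne (not_lt.mp h') fun e => hx ⟨k, e⟩

open Classical in
/-- The min-max symbol `ω_n^i`, `n ≥ 1`: its base tells whether `f^n` has a local minimum or a
local maximum at `c i` (for a multimodal map exactly one of the two is the case), its exponent is
the address of `f^n (c i)`. -/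
noncomputable def minMaxSymbol {a b : ℝ} {l : ℕ} (f : Icc a b → Icc a b) (c : Fin l → Icc a b)
    (n : ℕ) (i : Fin l) : MinMaxSymbol l where
  base := if IsLocalMin (f^[n]) (c i) then .m else .M
  exponent := kneadingSymbol c (f^[n] (c i))

/-- The set `{M^{I_1}, M^{c_1}, …, M^{I_i}, M^{c_i}, m^{c_i}, m^{I_{i+1}}, …, m^{c_l}, m^{I_{l+1}}}`
of bad symbols with respect to the `i`-th critical line (with indices starting at `0`). -/
def badSymbols {l : ℕ} (i : Fin l) : Set (MinMaxSymbol l) :=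
  {ω | (∃ j : Fin (l + 1), j ≤ i.castSucc ∧ ω = ⟨.M, .lap j⟩) ∨
       (∃ k : Fin l, k ≤ i ∧ ω = ⟨.M, .crit k⟩) ∨
       (∃ k : Fin l, i ≤ k ∧ ω = ⟨.m, .crit k⟩) ∨
       (∃ j : Fin (l + 1), i.castSucc < j ∧ ω = ⟨.m, .lap j⟩)}

/-- The curve `y = g x` crosses the horizontal line `y = g x₀` at `x₀`, from one side to the
other. -/
def CrossesAt {a b : ℝ} (g : Icc a b → Icc a b) (x₀ : Icc a b) : Prop :=
  ((∀ᶠ x in 𝓝[<] x₀, g x < g x₀) ∧ (∀ᶠ x in 𝓝[>] x₀, g x₀ < g x)) ∨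
  ((∀ᶠ x in 𝓝[<] x₀, g x₀ < g x) ∧ (∀ᶠ x in 𝓝[>] x₀, g x < g x₀))

/-- `s_ν^i`: the number of interior transversal solutions of `f^ν x = c i` that do not hit `c i`
before time `ν`. -/
noncomputable def crossCount {a b : ℝ} {l : ℕ} (f : Icc a b → Icc a b) (c : Fin l → Icc a b)
    (ν : ℕ) (i : Fin l) : ℕ :=
  {x : Icc a b | (x : ℝ) ∈ Ioo a b ∧ f^[ν] x = c i ∧ (∀ μ < ν, f^[μ] x ≠ c i) ∧
    CrossesAt (f^[ν]) x}.ncard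

open Classical in
/-- `K_ν^i`: the indices `(k, κ)`, `1 ≤ κ ≤ ν`, of the symbols `ω_κ^k` that are bad with respect to
the `i`-th critical line. -/
noncomputable def badIndices {a b : ℝ} {l : ℕ} (f : Icc a b → Icc a b) (c : Fin l → Icc a b)
    (ν : ℕ) (i : Fin l) : Finset (Fin l × ℕ) :=
  ((Finset.univ : Finset (Fin l)) ×ˢ Finset.Icc 1 ν).filter
    fun p => minMaxSymbol f c p.2 p.1 ∈ badSymbols i

/-- `S_ν^i`. -/
noncomputable def badSum {a b : ℝ} {l : ℕ} (f : Icc a b → Icc a b) (c : Fin l → Icc a b)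
    (ν : ℕ) (i : Fin l) : ℕ :=
  2 * ∑ p ∈ badIndices f c ν i, crossCount f c (ν - p.2) p.1

/-- `s_ν`, the sum of the `s_ν^i`. -/
noncomputable def totalCrossCount {a b : ℝ} {l : ℕ} (f : Icc a b → Icc a b)
    (c : Fin l → Icc a b) (ν : ℕ) : ℕ :=
  ∑ i, crossCount f c ν i

/-- `S_ν`, the sum of the `S_ν^i`. -/
noncomputable def totalBadSum {a b : ℝ} {l : ℕ} (f : Icc a b → Icc a b)
    (c : Fin l → Icc a b) (ν : ℕ) : ℕ :=
  ∑ i, badSum f c ν i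

/-! Write t_n for the number of points of `hitSet f c n`. Between neighbouring points of this set
f^n is strictly monotone, and the theorem follows by comparing both the entropy and the crossing
counts with t_n.

Entropy: t_n + 1 is submultiplicative, so log(t_n + 1)/n converges to some L by Fekete's lemma, and
L = h(f) in the manner of Misiurewicz and Szlenk. For h ≤ L (`coverEntropy_le`), separated orbit
segments are told apart by preimages of a fine finite set, and fibres of f^μ have at most t_μ + 1
points. For h ≥ L (`le_coverEntropy`), a fine dynamical ball of length kn contains at most 4^n
points of `hitSet f c (k * n)`, so L - (log 4)/k ≤ h for every k.

Counting: fix a line y = c_i. An interior point of `hitSet f c ν` is an extremum of f^ν. If its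
symbol is not bad, it is a minimum strictly below the line or a maximum strictly above it, and
between two such neighbours the graph must cross the line. Each bad point costs at most itself and
one missing crossing, whence the factor 2 in S_ν^i and the bound t_ν ≤ s_ν^i + S_ν^i + 3
(`ncard_hitSet_le`). Conversely every crossing count is at most t_ν + 1, so s_ν + S_ν is at most a
polynomial in ν times t_ν + 1. Both quantities therefore grow at the rate L. -/

/-- The points whose orbit meets a turning point before time `n`. -/
def hitSet {a b : ℝ} {l : ℕ} (f : Icc a b → Icc a b) (c : Fin l → Icc a b) (n : ℕ) :
    Set (Icc a b) :=
  {x | ∃ μ < n, f^[μ] x ∈ range c}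

/-! ### Monotone branches and fibres of the iterates -/

theorem isPreconnected_Icc_subtype {a b : ℝ} (x y : Icc a b) : IsPreconnected (Icc x y) := by
  rw [← Topology.IsInducing.subtypeVal.isPreconnected_image]
  have : Subtype.val '' Icc x y = Icc (x : ℝ) y := by
    ext z
    constructor
    · rintro ⟨w, hw, rfl⟩
      exact hw
    · intro hz
      exact ⟨⟨z, x.2.1.trans hz.1, hz.2.trans y.2.2⟩, hz, rfl⟩
  rw [this]
  exact isPreconnected_Icc

theorem exists_mem_Icc_apply_eq {a b : ℝ} {g : Icc a b → Icc a b} (hg : Continuous g)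
    {x y e : Icc a b} (hxy : x ≤ y) (he : e ∈ uIcc (g x) (g y)) : ∃ t ∈ Icc x y, g t = e := by
  have hpre := isPreconnected_Icc_subtype x y
  rcases le_total (g x) (g y) with h | h
  · rw [uIcc_of_le h] at he
    exact hpre.intermediate_value (left_mem_Icc.2 hxy) (right_mem_Icc.2 hxy) hg.continuousOn he
  · rw [uIcc_of_ge h] at he
    exact hpre.intermediate_value (right_mem_Icc.2 hxy) (left_mem_Icc.2 hxy) hg.continuousOn he

theorem StrictMonoOn.of_Ioo_of_continuous {α β : Type*} [LinearOrder α] [TopologicalSpace α]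
    [OrderTopology α] [DenselyOrdered α] [LinearOrder β] [TopologicalSpace β]
    [OrderClosedTopology β] {g : α → β} (hg : Continuous g) {x y : α}
    (h : StrictMonoOn g (Ioo x y)) : StrictMonoOn g (Icc x y) := by
  intro u hu v hv huv
  obtain ⟨p, hup, hpv⟩ := exists_between huv
  obtain ⟨q, hpq, hqv⟩ := exists_between hpv
  have hp : p ∈ Ioo x y := ⟨hu.1.trans_lt hup, hpv.trans_le hv.2⟩
  have hq : q ∈ Ioo x y := ⟨hu.1.trans_lt (hup.trans hpq), hqv.trans_le hv.2⟩
  have : (𝓝[>] u).NeBot := nhdsGT_neBot_of_exists_gt ⟨v, huv⟩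
  have : (𝓝[<] v).NeBot := nhdsLT_neBot_of_exists_lt ⟨u, huv⟩
  have h1 : g u ≤ g p := by
    refine le_of_tendsto (hg.continuousAt.tendsto.mono_left (nhdsWithin_le_nhds (s := Ioi u))) ?_
    filter_upwards [Ioo_mem_nhdsGT hup] with w hw
    exact (h ⟨hu.1.trans_lt hw.1, hw.2.trans hp.2⟩ hp hw.2).le
  have h2 : g q ≤ g v := by
    refine ge_of_tendsto (hg.continuousAt.tendsto.mono_left (nhdsWithin_le_nhds (s := Iio v))) ?_
    filter_upwards [Ioo_mem_nhdsLT hqv] with w hw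
    exact (h hq ⟨hq.1.trans hw.1, hw.2.trans_le hv.2⟩ hw.1).le
  exact h1.trans_lt ((h hp hq hpq).trans_le h2)

theorem StrictAntiOn.of_Ioo_of_continuous {α β : Type*} [LinearOrder α] [TopologicalSpace α]
    [OrderTopology α] [DenselyOrdered α] [LinearOrder β] [TopologicalSpace β]
    [OrderClosedTopology β] {g : α → β} (hg : Continuous g) {x y : α}
    (h : StrictAntiOn g (Ioo x y)) : StrictAntiOn g (Icc x y) :=
  StrictMonoOn.of_Ioo_of_continuous (β := βᵒᵈ) hg h

/-- The number of points of `T` below `x` is strictly increasing in `x ∈ S` and takes values in {0,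
…, |T|}. -/
theorem ncard_le_of_separated {α : Type*} [LinearOrder α] {S T : Set α} (hT : T.Finite)
    (h : ∀ x ∈ S, ∀ y ∈ S, x < y → ∃ t ∈ T, x ≤ t ∧ t < y) :
    S.Finite ∧ S.ncard ≤ T.ncard + 1 := by
  have hmono : StrictMonoOn (fun x => (T ∩ Iio x).ncard) S := by
    intro x hx y hy hxy
    obtain ⟨t, ht, hxt, hty⟩ := h x hx y hy hxy
    refine ncard_lt_ncard ⟨inter_subset_inter_right _ (Iio_subset_Iio hxy.le), fun hsub => ?_⟩
      (hT.inter_of_left _)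
    exact absurd (hsub ⟨ht, hty⟩).2 (not_lt.2 hxt)
  have hmaps : MapsTo (fun x => (T ∩ Iio x).ncard) S (Iio (T.ncard + 1)) := fun x _ =>
    Nat.lt_succ_of_le (ncard_le_ncard inter_subset_left hT)
  refine ⟨Set.Finite.of_injOn hmaps hmono.injOn (finite_Iio _), ?_⟩
  have := ncard_le_ncard_of_injOn _ (fun x hx => hmaps hx) hmono.injOn (finite_Iio _)
  simpa [Set.ncard_eq_toFinset_card'] using this

theorem ncard_preimage_le {α β : Type*} {g : α → β} {T : Set β} (hT : T.Finite) {K : ℕ}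
    (hfin : ∀ e, (g ⁻¹' {e}).Finite) (hK : ∀ e, (g ⁻¹' {e}).ncard ≤ K) :
    (g ⁻¹' T).Finite ∧ (g ⁻¹' T).ncard ≤ T.ncard * K := by
  have hU : g ⁻¹' T = ⋃ e ∈ hT.toFinset, g ⁻¹' {e} := by ext; simp
  refine ⟨?_, ?_⟩
  · rw [hU]
    exact hT.toFinset.finite_toSet.biUnion fun e _ => hfin e
  · rw [hU]
    refine (Finset.set_ncard_biUnion_le _ _).trans ?_
    refine (Finset.sum_le_card_nsmul _ _ K fun e _ => hK e).trans ?_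
    rw [smul_eq_mul, ncard_eq_toFinset_card T hT]

namespace IsMultimodal

variable {a b : ℝ} {l : ℕ} {f : Icc a b → Icc a b} {c : Fin l → Icc a b}

theorem strict_on_Icc (hf : IsMultimodal f c) {x y : Icc a b}
    (h : ∀ z ∈ Ioo x y, z ∉ range c) :
    StrictMonoOn f (Icc x y) ∨ StrictAntiOn f (Icc x y) := by
  rcases le_or_gt y x with hxy | hxy
  · left
    intro u hu v hv huv
    exact absurd ((hu.1.trans_lt huv).trans_le hv.2) (not_lt.2 hxy)
  obtain ⟨m, hm⟩ := exists_between hxy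
  have hlap := mem_lapInterval_lapIndex hf.strictMono
    (x := m) fun ⟨k, hk⟩ => h m hm ⟨k, hk.symm⟩
  have hsub : Ioo x y ⊆ lapInterval c (lapIndex c m) := by
    intro z hz k
    refine ⟨fun hk => ?_, fun hk => ?_⟩
    · have h1 := (hlap k).1 hk
      by_contra! h2
      refine h (c k) ⟨hz.1.trans_le h2, h1.trans hm.2⟩ ⟨k, rfl⟩
    · have h1 := (hlap k).2 hk
      by_contra! h2
      refine h (c k) ⟨hm.1.trans h1, h2.trans_lt hz.2⟩ ⟨k, rfl⟩
  rcases hf.strict_on_lap (lapIndex c m) with h1 | h1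
  · exact .inl (StrictMonoOn.of_Ioo_of_continuous hf.continuous (h1.mono hsub))
  · exact .inr (StrictAntiOn.of_Ioo_of_continuous hf.continuous (h1.mono hsub))

/-- Induction on `n`: f^n maps [x, y] monotonically onto the interval between its end values, and a
turning point strictly inside that interval would pull back to a point of (x, y) hitting at time n.
The ends of either interval may be turning points. -/
theorem strict_on_Icc_iterate (hf : IsMultimodal f c) (n : ℕ) {x y : Icc a b}
    (h : ∀ z ∈ Ioo x y, z ∉ hitSet f c n) :
    StrictMonoOn (f^[n]) (Icc x y) ∨ StrictAntiOn (f^[n]) (Icc x y) := by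
  rcases le_or_gt y x with hxy | hxy
  · left
    intro u hu v hv huv
    exact absurd ((hu.1.trans_lt huv).trans_le hv.2) (not_lt.2 hxy)
  induction n with
  | zero => exact .inl fun u _ v _ huv => huv
  | succ n ih =>
    have hx : x ∈ Icc x y := left_mem_Icc.2 hxy.le
    have hy : y ∈ Icc x y := right_mem_Icc.2 hxy.le
    have hn := ih fun z hz ⟨μ, hμ, hc⟩ => h z hz ⟨μ, hμ.trans n.lt_succ_self, hc⟩
    have key : ∀ t ∈ Icc x y, f^[n] t ≠ f^[n] x → f^[n] t ≠ f^[n] y → f^[n] t ∉ range c := by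
      intro t ht h1 h2 hc
      exact h t ⟨lt_of_le_of_ne ht.1 fun e => h1 (e ▸ rfl),
        lt_of_le_of_ne ht.2 fun e => h2 (e ▸ rfl)⟩ ⟨n, n.lt_succ_self, hc⟩
    have hcont := hf.continuous.iterate n
    rw [Function.iterate_succ']
    rcases hn with hn | hn
    · have hm : MapsTo (f^[n]) (Icc x y) (Icc (f^[n] x) (f^[n] y)) := hn.monotoneOn.mapsTo_Icc
      rcases hf.strict_on_Icc (x := f^[n] x) (y := f^[n] y) (by
        intro z hz
        obtain ⟨t, ht, rfl⟩ := exists_mem_Icc_apply_eq hcont hxy.le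
          (Icc_subset_uIcc (Ioo_subset_Icc_self hz))
        exact key t ht hz.1.ne' hz.2.ne) with h1 | h1
      · exact .inl (h1.comp hn hm)
      · exact .inr (h1.comp_strictMonoOn hn hm)
    · have hm : MapsTo (f^[n]) (Icc x y) (Icc (f^[n] y) (f^[n] x)) := hn.antitoneOn.mapsTo_Icc
      rcases hf.strict_on_Icc (x := f^[n] y) (y := f^[n] x) (by
        intro z hz
        obtain ⟨t, ht, rfl⟩ := exists_mem_Icc_apply_eq hcont hxy.le
          (Icc_subset_uIcc' (Ioo_subset_Icc_self hz))
        exact key t ht hz.2.ne hz.1.ne') with h1 | h1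
      · exact .inr (h1.comp_strictAntiOn hn hm)
      · exact .inl (h1.comp hn hm)

/-- Two points of a fibre are separated by `hitSet f c n`, since f^n is otherwise injective between
them. Finiteness is a hypothesis because this feeds the induction in `finite_hitSet`. -/
theorem finite_fiber_of_finite_hitSet (hf : IsMultimodal f c) {n : ℕ}
    (hn : (hitSet f c n).Finite) (e : Icc a b) :
    (f^[n] ⁻¹' {e}).Finite ∧ (f^[n] ⁻¹' {e}).ncard ≤ (hitSet f c n).ncard + 1 := by
  refine ncard_le_of_separated hn fun x hx y hy hxy => ?_
  by_contra! hcon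
  have h1 : f^[n] x = f^[n] y := hx.trans hy.symm
  have hx' : x ∈ Icc x y := left_mem_Icc.2 hxy.le
  have hy' : y ∈ Icc x y := right_mem_Icc.2 hxy.le
  rcases hf.strict_on_Icc_iterate n
    (x := x) (y := y) (fun z hz hzn => absurd hz.2 (not_lt.2 (hcon z hzn hz.1.le))) with h | h
  · exact (h hx' hy' hxy).ne h1
  · exact (h hx' hy' hxy).ne' h1

end IsMultimodal

section hitSet

variable {a b : ℝ} {l : ℕ} (f : Icc a b → Icc a b) (c : Fin l → Icc a b)

theorem hitSet_mono : Monotone (hitSet f c) := fun _ _ h _ ⟨μ, hμ, hc⟩ => ⟨μ, hμ.trans_le h, hc⟩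

theorem hitSet_add (m n : ℕ) : hitSet f c (m + n) = hitSet f c m ∪ f^[m] ⁻¹' hitSet f c n := by
  ext x
  constructor
  · rintro ⟨μ, hμ, hc⟩
    rcases lt_or_ge μ m with h | h
    · exact .inl ⟨μ, h, hc⟩
    · refine .inr ⟨μ - m, by omega, ?_⟩
      rwa [← Function.iterate_add_apply, Nat.sub_add_cancel h]
  · rintro (h | ⟨μ, hμ, hc⟩)
    · exact hitSet_mono f c (Nat.le_add_right m n) h
    · rw [← Function.iterate_add_apply] at hc
      exact ⟨μ + m, by omega, hc⟩

theorem hitSet_one : hitSet f c 1 = range c := by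
  ext x
  simp [hitSet]

end hitSet

namespace IsMultimodal

variable {a b : ℝ} {l : ℕ} {f : Icc a b → Icc a b} {c : Fin l → Icc a b}

theorem finite_hitSet (hf : IsMultimodal f c) (n : ℕ) : (hitSet f c n).Finite := by
  induction n with
  | zero => simp [hitSet]
  | succ n ih =>
    rw [hitSet_add, hitSet_one]
    exact ih.union (ncard_preimage_le (finite_range c)
      (fun e => (hf.finite_fiber_of_finite_hitSet ih e).1)
      (fun e => (hf.finite_fiber_of_finite_hitSet ih e).2)).1

theorem finite_fiber (hf : IsMultimodal f c) (n : ℕ) (e : Icc a b) : (f^[n] ⁻¹' {e}).Finite :=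
  (hf.finite_fiber_of_finite_hitSet (hf.finite_hitSet n) e).1

theorem ncard_fiber_le (hf : IsMultimodal f c) (n : ℕ) (e : Icc a b) :
    (f^[n] ⁻¹' {e}).ncard ≤ (hitSet f c n).ncard + 1 :=
  (hf.finite_fiber_of_finite_hitSet (hf.finite_hitSet n) e).2

theorem ncard_hitSet_mono (hf : IsMultimodal f c) : Monotone fun n => (hitSet f c n).ncard :=
  fun _ n h => ncard_le_ncard (hitSet_mono f c h) (hf.finite_hitSet n)

/-- By `hitSet_add`, t_{m+n} ≤ t_m + t_n (t_m + 1). -/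
theorem ncard_hitSet_add_le (hf : IsMultimodal f c) (m n : ℕ) :
    (hitSet f c (m + n)).ncard + 1 ≤ ((hitSet f c m).ncard + 1) * ((hitSet f c n).ncard + 1) := by
  have h1 := (ncard_preimage_le (hf.finite_hitSet n) (hf.finite_fiber m) (hf.ncard_fiber_le m)).2
  have h2 := ncard_union_le (hitSet f c m) (f^[m] ⁻¹' hitSet f c n)
  rw [← hitSet_add] at h2
  nlinarith

end IsMultimodal

/-! ### Entropy as the growth rate of `hitSet` -/

open Uniformity in
/-- Separated orbit segments are separated by the preimages of a fine finite set. -/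
theorem exists_finite_separating {a b : ℝ} {f : Icc a b → Icc a b} (hf : Continuous f)
    {V : SetRel (Icc a b) (Icc a b)} (hV : V ∈ 𝓤 (Icc a b)) :
    ∃ E : Set (Icc a b), E.Finite ∧ ∀ (μ : ℕ) (x y : Icc a b), x < y →
      (f^[μ] x, f^[μ] y) ∉ V → ∃ t, f^[μ] t ∈ E ∧ x < t ∧ t < y := by
  obtain ⟨ε, hε, hεV⟩ := Metric.mem_uniformity_dist.1 hV
  obtain ⟨E, -, hE, hcov⟩ := finite_cover_balls_of_compact (isCompact_univ (X := Icc a b))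
    (half_pos hε)
  refine ⟨E, hE, fun μ x y hxy hxyV => ?_⟩
  have key : ∀ u v : Icc a b, u < v → ε ≤ dist u v → ∃ e ∈ E, u < e ∧ e < v := by
    intro u v huv hd
    have hd' : ε ≤ (v : ℝ) - u := by
      rwa [Subtype.dist_eq, dist_comm, Real.dist_eq, abs_of_pos (sub_pos.2 (Subtype.coe_lt_coe.2 huv))] at hd
    -- A net point within ε/2 of the midpoint lies strictly between two points at distance at least
    -- ε.
    have hm : ((u : ℝ) + v) / 2 ∈ Icc a b :=
      ⟨by linarith [u.2.1, v.2.1], by linarith [u.2.2, v.2.2]⟩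
    obtain ⟨e, he, hde⟩ := mem_iUnion₂.1 (hcov (mem_univ (⟨_, hm⟩ : Icc a b)))
    rw [Metric.mem_ball, Subtype.dist_eq, Real.dist_eq, abs_lt] at hde
    exact ⟨e, he, Subtype.coe_lt_coe.1 (by linarith [hde.2]),
      Subtype.coe_lt_coe.1 (by linarith [hde.1])⟩
  have hd : ε ≤ dist (f^[μ] x) (f^[μ] y) := not_lt.1 fun h => hxyV (hεV h)
  have hne : f^[μ] x ≠ f^[μ] y := fun h => by
    rw [h, dist_self] at hd
    exact absurd hd (not_le.2 hε)
  have hcont := hf.iterate μ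
  rcases lt_or_gt_of_ne hne with h | h
  · obtain ⟨e, he, h1, h2⟩ := key _ _ h hd
    obtain ⟨t, ht, rfl⟩ := exists_mem_Icc_apply_eq hcont hxy.le (Icc_subset_uIcc ⟨h1.le, h2.le⟩)
    exact ⟨t, he, lt_of_le_of_ne ht.1 fun e => h1.ne (e ▸ rfl),
      lt_of_le_of_ne ht.2 fun e => h2.ne (e ▸ rfl)⟩
  · obtain ⟨e, he, h1, h2⟩ := key _ _ h (by rwa [dist_comm])
    obtain ⟨t, ht, rfl⟩ := exists_mem_Icc_apply_eq hcont hxy.le (Icc_subset_uIcc' ⟨h1.le, h2.le⟩)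
    exact ⟨t, he, lt_of_le_of_ne ht.1 fun e => h2.ne' (e ▸ rfl),
      lt_of_le_of_ne ht.2 fun e => h1.ne' (e ▸ rfl)⟩

/-- A finite set of points is uniformly isolated. -/
theorem Set.Finite.exists_ball_subsingleton {X : Type*} [MetricSpace X] {T : Set X}
    (hT : T.Finite) : ∃ ε > 0, ∀ z : X, ∃ p, ∀ t ∈ T, dist t z < ε → t = p := by
  obtain ⟨C, hC, h⟩ := hT.relatively_discrete
  obtain ⟨r, hr, hrC⟩ := ENNReal.lt_iff_exists_real_btwn.1 hC
  have hr0 : 0 < r := ENNReal.ofReal_pos.1 hrC.1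
  refine ⟨r / 2, half_pos hr0, fun z => ?_⟩
  by_cases hz : ∃ p ∈ T, dist p z < r / 2
  · obtain ⟨p, hp, hpz⟩ := hz
    refine ⟨p, fun t ht htz => ?_⟩
    by_contra hne
    have h1 := hrC.2.trans_le (h t ht p hp hne)
    have h2 : dist t p < r := by linarith [dist_triangle_right t p z]
    rw [edist_dist] at h1
    exact absurd ((ENNReal.ofReal_lt_ofReal_iff_of_nonneg hr).1 h1) (not_lt.2 h2.le)
  · push Not at hz
    exact ⟨z, fun t ht htz => absurd htz (not_lt.2 (hz t ht))⟩

namespace IsMultimodal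

variable {a b : ℝ} {l : ℕ} {f : Icc a b → Icc a b} {c : Fin l → Icc a b}

-- A minimal cover at scale U is no larger than a maximal separated set at a scale V with V ∘ V ⊆ U.
-- Such a set is separated by the preimages f^{-μ}(E), μ < n, of a finite set E, and |E| serves as
-- `M`.
open Uniformity Dynamics in
theorem coverMincard_le (hf : IsMultimodal f c) {U : SetRel (Icc a b) (Icc a b)}
    (hU : U ∈ 𝓤 (Icc a b)) :
    ∃ M : ℕ, ∀ n, coverMincard f univ U n ≤ ((n * (M * ((hitSet f c n).ncard + 1)) + 1 : ℕ) : ℕ∞)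
    := by
  obtain ⟨V, hV, hsymm, hVU⟩ := comp_symm_mem_uniformity_sets hU
  have hrefl : SetRel.IsRefl V := isRefl_of_mem_uniformity hV
  obtain ⟨E, hE, hsep⟩ := exists_finite_separating hf.continuous hV
  refine ⟨E.ncard, fun n => ?_⟩
  refine (coverMincard_antitone f univ n hVU).trans ?_
  refine (coverMincard_le_netMaxcard f univ n).trans ?_
  refine iSup₂_le fun s hs => ?_
  have hfib : ∀ μ, (f^[μ] ⁻¹' E).Finite ∧
      (f^[μ] ⁻¹' E).ncard ≤ E.ncard * ((hitSet f c μ).ncard + 1) := fun μ =>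
    ncard_preimage_le hE (hf.finite_fiber μ) (hf.ncard_fiber_le μ)
  have hfin : (⋃ μ ∈ Finset.range n, f^[μ] ⁻¹' E).Finite :=
    (Finset.range n).finite_toSet.biUnion fun μ _ => (hfib μ).1
  have hcard : (⋃ μ ∈ Finset.range n, f^[μ] ⁻¹' E).ncard
      ≤ n * (E.ncard * ((hitSet f c n).ncard + 1)) := by
    refine (Finset.set_ncard_biUnion_le _ _).trans ?_
    refine (Finset.sum_le_card_nsmul _ _ (E.ncard * ((hitSet f c n).ncard + 1))
      fun μ hμ => (hfib μ).2.trans ?_).trans (by simp)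
    exact Nat.mul_le_mul_left _
      (Nat.succ_le_succ (hf.ncard_hitSet_mono (Finset.mem_range.1 hμ).le))
  have := (ncard_le_of_separated (S := (s : Set (Icc a b))) hfin fun x hx y hy hxy => ?_).2
  · rw [ncard_coe_finset] at this
    exact_mod_cast this.trans (Nat.succ_le_succ hcard)
  · have hdisj := hs.2 hx hy hxy.ne
    have hnot : (x, y) ∉ dynEntourage f V n := fun h =>
      Set.disjoint_left.1 hdisj h (show (y, y) ∈ dynEntourage f V n from SetRel.refl _ y)
    rw [mem_dynEntourage] at hnot
    push Not at hnot
    obtain ⟨μ, hμ, hxyV⟩ := hnot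
    obtain ⟨t, ht, h1, h2⟩ := hsep μ x y hxy hxyV
    exact ⟨t, mem_biUnion (x := μ) (by simpa using hμ) ht, h1.le, h2⟩

theorem Icc_disjoint_hitSet_add (hf : IsMultimodal f c) {m k : ℕ} {x y : Icc a b} (hxy : x < y)
    (hm : ∀ z ∈ Icc x y, z ∉ hitSet f c m)
    (hk : f^[m] x ≠ f^[m] y → ∀ w ∈ uIcc (f^[m] x) (f^[m] y), w ∉ hitSet f c k) :
    ∀ z ∈ Icc x y, z ∉ hitSet f c (m + k) := by
  intro z hz hzm
  rw [hitSet_add] at hzm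
  rcases hzm with h | h
  · exact hm z hz h
  have hx' : x ∈ Icc x y := left_mem_Icc.2 hxy.le
  have hy' : y ∈ Icc x y := right_mem_Icc.2 hxy.le
  rcases hf.strict_on_Icc_iterate m fun z hz => hm z (Ioo_subset_Icc_self hz) with hs | hs
  · exact hk (hs hx' hy' hxy).ne _ (Icc_subset_uIcc (hs.monotoneOn.mapsTo_Icc hz)) h
  · exact hk (hs hx' hy' hxy).ne' _ (Icc_subset_uIcc' (hs.antitoneOn.mapsTo_Icc hz)) h

-- At scale ε each ball meets `hitSet f c k` in at most one point p. Inside one dynamical ball, a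
-- point is coded by the position of its orbit relative to p at the times 0, k, …, k(n-1). Distinct
-- points of `hitSet f c (k * n)` have distinct codes, and there are at most 4^n codes.
open Uniformity Dynamics in
theorem ncard_hitSet_mul_le (hf : IsMultimodal f c) (k : ℕ) (hk : 0 < k) :
    ∃ U ∈ 𝓤 (Icc a b), ∀ (n : ℕ) (s : Finset (Icc a b)), IsDynCoverOf f univ U (k * n) s →
      (hitSet f c (k * n)).ncard ≤ 4 ^ n * s.card := by
  classical
  obtain ⟨ε, hε, hiso⟩ := (hf.finite_hitSet k).exists_ball_subsingleton
  choose p hp using hiso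
  refine ⟨{x | dist x.1 x.2 < ε}, Metric.dist_mem_uniformity hε, fun n s hs => ?_⟩
  have hsub : hitSet f c (k * n) ⊆ ⋃ z ∈ s, {x | x ∈ hitSet f c (k * n) ∧
      (x, z) ∈ dynEntourage f {x : Icc a b × Icc a b | dist x.1 x.2 < ε} (k * n)} := by
    intro x hx
    obtain ⟨z, hz, hxz⟩ := hs (mem_univ x)
    exact mem_biUnion (x := z) hz ⟨hx, hxz⟩
  refine (ncard_le_ncard hsub ((hf.finite_hitSet (k * n)).subset ?_)).trans ?_
  · exact iUnion₂_subset fun z _ x hx => hx.1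
  refine (Finset.set_ncard_biUnion_le _ _).trans ?_
  refine (Finset.sum_le_card_nsmul s _ (4 ^ n) fun z _ => ?_).trans
    (by rw [smul_eq_mul, mul_comm])
  let code : Icc a b → Fin n → Bool × Bool := fun x i =>
    (decide (f^[k * i] x < p (f^[k * i] z)), decide (p (f^[k * i] z) < f^[k * i] x))
  have hinj : ∀ x y : Icc a b, x < y → x ∈ hitSet f c (k * n) →
      (x, z) ∈ dynEntourage f {x : Icc a b × Icc a b | dist x.1 x.2 < ε} (k * n) →
      (y, z) ∈ dynEntourage f {x : Icc a b × Icc a b | dist x.1 x.2 < ε} (k * n) →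
      code x ≠ code y := by
    intro x y hxy hx hxz hyz hcode
    rw [mem_dynEntourage] at hxz hyz
    -- If x < y share a code, no point of [x, y] hits before time kn, which contradicts the choice
    -- of x.
    have hind : ∀ i ≤ n, ∀ w ∈ Icc x y, w ∉ hitSet f c (k * i) := by
      intro i
      induction i with
      | zero => intro _ w _ hw; simp [hitSet] at hw
      | succ i ih =>
        intro hi
        have hkn : k * i < k * n := Nat.mul_lt_mul_of_pos_left hi hk
        rw [mul_add, mul_one]
        refine hf.Icc_disjoint_hitSet_add hxy (ih (Nat.le_of_succ_le hi)) fun hne w hw hwk => ?_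
        have hball : dist w (f^[k * i] z) < ε := by
          have h1 : dist (f^[k * i] x) (f^[k * i] z) < ε := hxz _ hkn
          have h2 : dist (f^[k * i] y) (f^[k * i] z) < ε := hyz _ hkn
          rw [Subtype.dist_eq, Real.dist_eq, abs_lt] at h1 h2 ⊢
          rcases mem_uIcc.1 hw with ⟨h3, h4⟩ | ⟨h3, h4⟩
          all_goals
            have h3' := Subtype.coe_le_coe.2 h3
            have h4' := Subtype.coe_le_coe.2 h4
            constructor <;> linarith [h1.1, h1.2, h2.1, h2.2]
        have hwp := hp _ w hwk hball
        have hc := congrFun hcode ⟨i, hi⟩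
        simp only [code, Prod.mk.injEq, decide_eq_decide, ← hwp] at hc
        -- Here w is the only candidate p, and equal codes put both images on the same side of w. As
        -- w lies between them, both must equal w, contrary to `hne`.
        rcases mem_uIcc.1 hw with ⟨h3, h4⟩ | ⟨h3, h4⟩
        · rcases h3.lt_or_eq with h | h
          · exact absurd (hc.1.1 h) (not_lt.2 h4)
          · rcases h4.lt_or_eq with h' | h'
            · exact absurd (hc.2.2 h') (not_lt.2 h3)
            · exact hne (h.trans h')
        · rcases h3.lt_or_eq with h | h
          · exact absurd (hc.1.2 h) (not_lt.2 h4)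
          · rcases h4.lt_or_eq with h' | h'
            · exact absurd (hc.2.1 h') (not_lt.2 h3)
            · exact hne (h.trans h').symm
    exact hind n le_rfl x (left_mem_Icc.2 hxy.le) hx
  have := ncard_le_ncard_of_injOn (t := (univ : Set (Fin n → Bool × Bool))) code
    (fun _ _ => mem_univ _) (s := {x | x ∈ hitSet f c (k * n) ∧
      (x, z) ∈ dynEntourage f {x : Icc a b × Icc a b | dist x.1 x.2 < ε} (k * n)}) (by
    intro x hx y hy hxy
    by_contra hne
    rcases lt_or_gt_of_ne hne with h | h
    · exact hinj x y h hx.1 hx.2 hy.2 hxy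
    · exact hinj y x h hy.1 hy.2 hx.2 hxy.symm) finite_univ
  simpa [ncard_univ] using this

end IsMultimodal

theorem ENNReal.log_natCast {N : ℕ} (hN : N ≠ 0) :
    ENNReal.log (N : ENNReal) = ((Real.log N : ℝ) : EReal) := by
  rw [← ENNReal.ofReal_natCast, ENNReal.log_ofReal_of_pos]
  exact_mod_cast Nat.pos_of_ne_zero hN

/-- Polynomial factors do not affect exponential growth rates. -/
theorem tendsto_log_mul_add_one_div (M : ℕ) :
    Tendsto (fun n : ℕ => Real.log ((n : ℝ) * M + 1) / n) atTop (𝓝 0) := by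
  have h1 : Tendsto (fun n : ℕ => Real.log n / n + Real.log ((M : ℝ) + 1) / n) atTop (𝓝 (0 + 0)) :=
    ((Real.isLittleO_log_id_atTop.tendsto_div_nhds_zero).comp tendsto_natCast_atTop_atTop).add
      (tendsto_const_nhds.div_atTop tendsto_natCast_atTop_atTop)
  rw [add_zero] at h1
  refine squeeze_zero' (Eventually.of_forall fun n => ?_) ?_ h1
  · exact div_nonneg (Real.log_nonneg (by have : (0 : ℝ) ≤ n * M := by positivity
                                          linarith)) n.cast_nonneg
  · filter_upwards [eventually_ge_atTop 1] with n hn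
    have hn' : (1 : ℝ) ≤ n := by exact_mod_cast hn
    rw [← add_div, ← Real.log_mul (by positivity) (by positivity)]
    refine div_le_div_of_nonneg_right (Real.log_le_log (by positivity) ?_) (by positivity)
    linarith

namespace IsMultimodal

variable {a b : ℝ} {l : ℕ} {f : Icc a b → Icc a b} {c : Fin l → Icc a b}

theorem subadditive_log_ncard_hitSet (hf : IsMultimodal f c) :
    Subadditive fun n => Real.log ((hitSet f c n).ncard + 1) := by
  intro m n
  rw [← Real.log_mul (by positivity) (by positivity)]
  exact Real.log_le_log (by positivity) (by exact_mod_cast hf.ncard_hitSet_add_le m n)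

theorem exists_tendsto_log_ncard_hitSet (hf : IsMultimodal f c) :
    ∃ L : ℝ, Tendsto (fun n : ℕ => Real.log ((hitSet f c n).ncard + 1) / n) atTop (𝓝 L) := by
  refine ⟨_, hf.subadditive_log_ncard_hitSet.tendsto_lim ⟨0, ?_⟩⟩
  rintro _ ⟨n, rfl⟩
  exact div_nonneg (Real.log_nonneg (by simp)) n.cast_nonneg

open Dynamics Uniformity in
theorem coverEntropy_le (hf : IsMultimodal f c) {L : ℝ}
    (hL : Tendsto (fun n : ℕ => Real.log ((hitSet f c n).ncard + 1) / n) atTop (𝓝 L)) :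
    coverEntropy f univ ≤ (L : EReal) := by
  refine iSup₂_le fun U hU => ?_
  obtain ⟨M, hM⟩ := hf.coverMincard_le hU
  have hlim : Tendsto (fun n : ℕ => ((Real.log ((n : ℝ) * M + 1) / n +
      Real.log ((hitSet f c n).ncard + 1) / n : ℝ) : EReal)) atTop (𝓝 (L : EReal)) := by
    have := (tendsto_log_mul_add_one_div M).add hL
    rw [zero_add] at this
    exact (continuous_coe_real_ereal.tendsto L).comp this
  rw [← hlim.limsup_eq]
  refine limsup_le_limsup (Eventually.of_forall fun n => ?_)
  have h1 : coverMincard f univ U n ≤ (((n * M + 1) * ((hitSet f c n).ncard + 1) : ℕ) : ℕ∞) := by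
    refine (hM n).trans ?_
    exact_mod_cast show n * (M * ((hitSet f c n).ncard + 1)) + 1
      ≤ (n * M + 1) * ((hitSet f c n).ncard + 1) by nlinarith
  have h2 : ENNReal.log (coverMincard f univ U n : ENNReal) ≤
      ((Real.log ((n : ℝ) * M + 1) + Real.log ((hitSet f c n).ncard + 1) : ℝ) : EReal) := by
    refine (ENNReal.log_monotone (ENat.toENNReal_mono h1)).trans ?_
    rw [ENat.toENNReal_coe, ENNReal.log_natCast (by positivity),
      ← Real.log_mul (by positivity) (by positivity)]
    push_cast
    exact le_rfl
  refine (EReal.monotone_div_right_of_nonneg (by positivity) h2).trans ?_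
  simp only [← add_div, EReal.coe_div]
  exact le_rfl

open Dynamics Uniformity in
theorem le_coverEntropy [Nonempty (Icc a b)] (hf : IsMultimodal f c) {L : ℝ}
    (hL : Tendsto (fun n : ℕ => Real.log ((hitSet f c n).ncard + 1) / n) atTop (𝓝 L))
    {k : ℕ} (hk : 0 < k) :
    ((L - Real.log 4 / k : ℝ) : EReal) ≤ coverEntropy f univ := by
  obtain ⟨U, hU, hcard⟩ := hf.ncard_hitSet_mul_le k hk
  refine le_trans ?_ (coverEntropyEntourage_le_coverEntropy f univ hU)
  -- The entropy at a fixed scale is a limsup, so a lower bound along the multiples of k suffices.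
  have hkn : Tendsto (fun n : ℕ => k * n) atTop atTop :=
    tendsto_id.const_mul_atTop' hk
  have hlim : Tendsto (fun n : ℕ => Real.log ((hitSet f c (k * n)).ncard + 1) / (k * n : ℕ)
      - Real.log 4 / k - Real.log 2 / (k * n : ℕ)) atTop (𝓝 (L - Real.log 4 / k)) := by
    have h0 : Tendsto (fun n : ℕ => Real.log 2 / (k * n : ℕ)) atTop (𝓝 0) :=
      tendsto_const_nhds.div_atTop (tendsto_natCast_atTop_atTop.comp hkn)
    have := ((hL.comp hkn).sub_const (Real.log 4 / k)).sub h0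
    rwa [sub_zero] at this
  refine EReal.ge_of_forall_gt_iff_ge.1 fun r hr => ?_
  rw [coverEntropyEntourage, ExpGrowth.expGrowthSup]
  refine le_limsup_of_frequently_le ?_ (by isBoundedDefault)
  have hev : ∀ᶠ n : ℕ in atTop, (r : EReal) ≤
      ENNReal.log (coverMincard f univ U (k * n) : ENNReal) / ((k * n : ℕ) : EReal) := by
    filter_upwards [hlim.eventually (lt_mem_nhds (EReal.coe_lt_coe_iff.1 hr)),
      eventually_ge_atTop 1] with n hn hn1
    obtain ⟨s, hs, hsc⟩ := (coverMincard_finite_iff f univ U (k * n)).1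
      (coverMincard_finite_of_isCompact_invariant isCompact_univ (mapsTo_univ f univ) hU (k * n))
    have hs0 : 0 < s.card := Finset.card_pos.2 (hs.nonempty univ_nonempty)
    have hkn0 : (0 : ℝ) < (k * n : ℕ) := by exact_mod_cast Nat.mul_pos hk hn1
    have hk0 : (0 : ℝ) < k := by exact_mod_cast hk
    have hn0 : (0 : ℝ) < n := by exact_mod_cast hn1
    have hs1 : (0 : ℝ) < s.card := by exact_mod_cast hs0
    -- The factor 2 absorbs the summand 1; it is the source of the vanishing term (log 2)/(kn).
    have h1 : (hitSet f c (k * n)).ncard + 1 ≤ 2 * (4 ^ n * s.card) := by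
      have := hcard n s hs
      have := Nat.mul_pos (pow_pos (show 0 < 4 by norm_num) n) hs0
      omega
    have h2 : Real.log ((hitSet f c (k * n)).ncard + 1) ≤
        Real.log 2 + (n * Real.log 4 + Real.log s.card) := by
      rw [← Real.log_pow, ← Real.log_mul (by positivity) hs1.ne',
        ← Real.log_mul (by positivity) (by positivity)]
      exact Real.log_le_log (by positivity) (by exact_mod_cast h1)
    have h3 : r ≤ Real.log s.card / (k * n : ℕ) := by
      refine hn.le.trans ?_
      have h4 : Real.log 4 / k = n * Real.log 4 / (k * n : ℕ) := by
        push_cast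
        field_simp
      rw [h4, ← sub_div, ← sub_div]
      exact div_le_div_of_nonneg_right (by linarith) hkn0.le
    rw [← hsc, ENat.toENNReal_coe, ENNReal.log_natCast hs0.ne']
    refine (EReal.coe_le_coe_iff.2 h3).trans ?_
    rw [EReal.coe_div]
    exact le_rfl
  exact hkn.frequently hev.frequently

open Dynamics in
theorem tendsto_log_ncard_hitSet [Nonempty (Icc a b)] (hf : IsMultimodal f c) :
    ∃ L : ℝ, Tendsto (fun n : ℕ => Real.log ((hitSet f c n).ncard + 1) / n) atTop (𝓝 L) ∧
      coverEntropy f univ = (L : EReal) := by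
  obtain ⟨L, hL⟩ := hf.exists_tendsto_log_ncard_hitSet
  refine ⟨L, hL, (hf.coverEntropy_le hL).antisymm ?_⟩
  have h1 : Tendsto (fun k : ℕ => L - Real.log 4 / k) atTop (𝓝 (L - 0)) :=
    (tendsto_const_nhds.div_atTop tendsto_natCast_atTop_atTop).const_sub L
  rw [sub_zero] at h1
  refine le_of_tendsto ((continuous_coe_real_ereal.tendsto L).comp h1) ?_
  filter_upwards [eventually_ge_atTop 1] with k hk
  exact hf.le_coverEntropy hL hk

end IsMultimodal

/-! ### Extrema of the iterates, transversal crossings and bad symbols -/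

theorem StrictMonoOn.not_isLocalMax_left {α β : Type*} [LinearOrder α] [TopologicalSpace α]
    [OrderTopology α] [DenselyOrdered α] [Preorder β] {g : α → β} {p q : α}
    (h : StrictMonoOn g (Icc p q)) (hpq : p < q) : ¬ IsLocalMax g p := by
  intro hmax
  have : (𝓝[>] p).NeBot := nhdsGT_neBot_of_exists_gt ⟨q, hpq⟩
  obtain ⟨x, hx, hxI⟩ := ((hmax.filter_mono nhdsWithin_le_nhds).and (Ioo_mem_nhdsGT hpq)).exists
  exact (h (left_mem_Icc.2 hpq.le) (Ioo_subset_Icc_self hxI) hxI.1).not_ge hx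

theorem StrictMonoOn.not_isLocalMin_right {α β : Type*} [LinearOrder α] [TopologicalSpace α]
    [OrderTopology α] [DenselyOrdered α] [Preorder β] {g : α → β} {p q : α}
    (h : StrictMonoOn g (Icc p q)) (hpq : p < q) : ¬ IsLocalMin g q := by
  intro hmin
  have : (𝓝[<] q).NeBot := nhdsLT_neBot_of_exists_lt ⟨p, hpq⟩
  obtain ⟨x, hx, hxI⟩ := ((hmin.filter_mono nhdsWithin_le_nhds).and (Ioo_mem_nhdsLT hpq)).exists
  exact (h (Ioo_subset_Icc_self hxI) (right_mem_Icc.2 hpq.le) hxI.2).not_ge hx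

theorem StrictAntiOn.not_isLocalMin_left {α β : Type*} [LinearOrder α] [TopologicalSpace α]
    [OrderTopology α] [DenselyOrdered α] [Preorder β] {g : α → β} {p q : α}
    (h : StrictAntiOn g (Icc p q)) (hpq : p < q) : ¬ IsLocalMin g p :=
  StrictMonoOn.not_isLocalMax_left (β := βᵒᵈ) h hpq

theorem StrictAntiOn.not_isLocalMax_right {α β : Type*} [LinearOrder α] [TopologicalSpace α]
    [OrderTopology α] [DenselyOrdered α] [Preorder β] {g : α → β} {p q : α}
    (h : StrictAntiOn g (Icc p q)) (hpq : p < q) : ¬ IsLocalMax g q :=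
  StrictMonoOn.not_isLocalMin_right (β := βᵒᵈ) h hpq

theorem not_crossesAt_of_isLocalExtr {a b : ℝ} {g : Icc a b → Icc a b} {x : Icc a b}
    (hx : (x : ℝ) ∈ Ioo a b) (hg : IsLocalExtr g x) : ¬ CrossesAt g x := by
  have hab : a ≤ b := (hx.1.trans hx.2).le
  have : (𝓝[>] x).NeBot := nhdsGT_neBot_of_exists_gt ⟨⟨b, right_mem_Icc.2 hab⟩, hx.2⟩
  have : (𝓝[<] x).NeBot := nhdsLT_neBot_of_exists_lt ⟨⟨a, left_mem_Icc.2 hab⟩, hx.1⟩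
  intro hc
  rcases hg with hg | hg <;> rcases hc with ⟨h1, h2⟩ | ⟨h1, h2⟩
  · obtain ⟨y, hy, hy'⟩ := (h1.and (hg.filter_mono nhdsWithin_le_nhds)).exists
    exact hy.not_ge hy'
  · obtain ⟨y, hy, hy'⟩ := (h2.and (hg.filter_mono nhdsWithin_le_nhds)).exists
    exact hy.not_ge hy'
  · obtain ⟨y, hy, hy'⟩ := (h2.and (hg.filter_mono nhdsWithin_le_nhds)).exists
    exact hy.not_ge hy'
  · obtain ⟨y, hy, hy'⟩ := (h1.and (hg.filter_mono nhdsWithin_le_nhds)).exists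
    exact hy.not_ge hy'

/-- The interior points whose orbit meets the turning points for the first time at time `ν`,
in `c i`. -/
def firstHit {a b : ℝ} {l : ℕ} (f : Icc a b → Icc a b) (c : Fin l → Icc a b) (ν : ℕ)
    (i : Fin l) : Set (Icc a b) :=
  {x | (x : ℝ) ∈ Ioo a b ∧ f^[ν] x = c i ∧ x ∉ hitSet f c ν}

/-- This is the geometric meaning of not being bad. A base `M` only records the absence of a local
minimum; `isLocalExtr_iterate` later turns this into a local maximum. -/
theorem lt_or_gt_of_minMaxSymbol_notMem {a b : ℝ} {l : ℕ} {f : Icc a b → Icc a b}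
    {c : Fin l → Icc a b} (hc : StrictMono c) {κ : ℕ} {k i : Fin l}
    (h : minMaxSymbol f c κ k ∉ badSymbols i) :
    (IsLocalMin (f^[κ]) (c k) ∧ f^[κ] (c k) < c i) ∨
      (¬ IsLocalMin (f^[κ]) (c k) ∧ c i < f^[κ] (c k)) := by
  simp only [badSymbols, mem_ofPred_eq, not_or, not_exists, not_and] at h
  obtain ⟨hMl, hMc, hmc, hml⟩ := h
  by_cases hmin : IsLocalMin (f^[κ]) (c k)
  · refine .inl ⟨hmin, ?_⟩
    by_cases hex : ∃ j, f^[κ] (c k) = c j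
    · have hsym : minMaxSymbol f c κ k = ⟨.m, .crit hex.choose⟩ := by
        simp [minMaxSymbol, kneadingSymbol, hmin, hex]
      rw [hex.choose_spec]
      exact hc (not_le.1 fun hle => hmc _ hle hsym)
    · have hsym : minMaxSymbol f c κ k = ⟨.m, .lap (lapIndex c (f^[κ] (c k)))⟩ := by
        simp [minMaxSymbol, kneadingSymbol, hmin, hex]
      exact (mem_lapInterval_lapIndex hc hex i).2 (not_lt.1 fun hlt => hml _ hlt hsym)
  · refine .inr ⟨hmin, ?_⟩
    by_cases hex : ∃ j, f^[κ] (c k) = c j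
    · have hsym : minMaxSymbol f c κ k = ⟨.M, .crit hex.choose⟩ := by
        simp [minMaxSymbol, kneadingSymbol, hmin, hex]
      rw [hex.choose_spec]
      exact hc (not_le.1 fun hle => hMc _ hle hsym)
    · have hsym : minMaxSymbol f c κ k = ⟨.M, .lap (lapIndex c (f^[κ] (c k)))⟩ := by
        simp [minMaxSymbol, kneadingSymbol, hmin, hex]
      exact (mem_lapInterval_lapIndex hc hex i).1 (not_le.1 fun hlt => hMl _ hlt hsym)

theorem ncard_endpoints_le (a b : ℝ) : {x : Icc a b | (x : ℝ) ∉ Ioo a b}.ncard ≤ 2 := by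
  refine (ncard_le_ncard_of_injOn (t := {a, b}) Subtype.val ?_ Subtype.val_injective.injOn
    (toFinite _)).trans ((ncard_insert_le a {b}).trans (by simp))
  intro x hx
  by_contra hne
  simp only [mem_insert_iff, mem_singleton_iff, not_or] at hne
  exact hx ⟨lt_of_le_of_ne x.2.1 (Ne.symm hne.1), lt_of_le_of_ne x.2.2 hne.2⟩

theorem finite_endpoints (a b : ℝ) : {x : Icc a b | (x : ℝ) ∉ Ioo a b}.Finite := by
  refine Finite.of_finite_image (f := Subtype.val) ((toFinite {a, b}).subset ?_)
    Subtype.val_injective.injOn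
  rintro _ ⟨x, hx, rfl⟩
  by_contra hne
  simp only [mem_insert_iff, mem_singleton_iff, not_or] at hne
  exact hx ⟨lt_of_le_of_ne x.2.1 (Ne.symm hne.1), lt_of_le_of_ne x.2.2 hne.2⟩

namespace IsMultimodal

variable {a b : ℝ} {l : ℕ} {f : Icc a b → Icc a b} {c : Fin l → Icc a b}

theorem exists_mem_nhdsLE_monotone_or_antitone (hf : IsMultimodal f c) (n : ℕ) (y : Icc a b) :
    ∃ s ∈ 𝓝[≤] y, MonotoneOn (f^[n]) s ∨ AntitoneOn (f^[n]) s := by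
  by_cases hy : ∃ u, u < y
  · have hT : (hitSet f c n ∩ Iio y)ᶜ ∈ 𝓝 y :=
      ((hf.finite_hitSet n).inter_of_left _).isClosed.isOpen_compl.mem_nhds fun h =>
        lt_irrefl y h.2
    obtain ⟨u, hu, hsub⟩ := exists_Ioc_subset_of_mem_nhds hT hy
    refine ⟨Icc u y, Icc_mem_nhdsLE hu, ?_⟩
    exact (hf.strict_on_Icc_iterate n fun z hz hzn =>
      hsub (Ioo_subset_Ioc_self hz) ⟨hzn, hz.2⟩).imp (·.monotoneOn) (·.antitoneOn)
  · push Not at hy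
    refine ⟨Iic y, self_mem_nhdsWithin, .inl fun u hu v hv _ => ?_⟩
    rw [le_antisymm hu (hy u), le_antisymm hv (hy v)]

theorem exists_mem_nhdsGE_monotone_or_antitone (hf : IsMultimodal f c) (n : ℕ) (y : Icc a b) :
    ∃ s ∈ 𝓝[≥] y, MonotoneOn (f^[n]) s ∨ AntitoneOn (f^[n]) s := by
  by_cases hy : ∃ u, y < u
  · have hT : (hitSet f c n ∩ Ioi y)ᶜ ∈ 𝓝 y :=
      ((hf.finite_hitSet n).inter_of_left _).isClosed.isOpen_compl.mem_nhds fun h =>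
        lt_irrefl y h.2
    obtain ⟨u, hu, hsub⟩ := exists_Ico_subset_of_mem_nhds hT hy
    refine ⟨Icc y u, Icc_mem_nhdsGE hu, ?_⟩
    exact (hf.strict_on_Icc_iterate n fun z hz hzn =>
      hsub (Ioo_subset_Ico_self hz) ⟨hzn, hz.1⟩).imp (·.monotoneOn) (·.antitoneOn)
  · push Not at hy
    refine ⟨Ici y, self_mem_nhdsWithin, .inl fun u hu v hv _ => ?_⟩
    rw [le_antisymm (hy u) hu, le_antisymm (hy v) hv]

/-- Near c_k, f takes values on one side of f(c_k) only, and by finiteness of `hitSet f c n` the map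
f^n is monotone on a one-sided neighbourhood of f(c_k). -/
theorem isLocalExtr_iterate (hf : IsMultimodal f c) (n : ℕ) (k : Fin l) :
    IsLocalExtr (f^[n + 1]) (c k) := by
  have hcont := hf.continuous.tendsto (c k)
  rw [Function.iterate_succ]
  rcases hf.isLocalExtr k with h | h
  · obtain ⟨s, hs, hmono⟩ := hf.exists_mem_nhdsGE_monotone_or_antitone n (f (c k))
    have hev : ∀ᶠ x in 𝓝 (c k), f x ∈ s :=
      (tendsto_nhdsWithin_iff.2 ⟨hcont, h.mono fun _ hx => hx⟩).eventually_mem hs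
    have hck : f (c k) ∈ s := mem_of_mem_nhdsWithin self_mem_Ici hs
    rcases hmono with hm | hm
    · left
      filter_upwards [h, hev] with x hx hxs
      exact hm hck hxs hx
    · right
      filter_upwards [h, hev] with x hx hxs
      exact hm hck hxs hx
  · obtain ⟨s, hs, hmono⟩ := hf.exists_mem_nhdsLE_monotone_or_antitone n (f (c k))
    have hev : ∀ᶠ x in 𝓝 (c k), f x ∈ s :=
      (tendsto_nhdsWithin_iff.2 ⟨hcont, h.mono fun _ hx => hx⟩).eventually_mem hs
    have hck : f (c k) ∈ s := mem_of_mem_nhdsWithin self_mem_Iic hs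
    rcases hmono with hm | hm
    · right
      filter_upwards [h, hev] with x hx hxs
      exact hm hxs hck hx
    · left
      filter_upwards [h, hev] with x hx hxs
      exact hm hxs hck hx

theorem isLocalMin_iterate_add (hf : IsMultimodal f c) {κ μ : ℕ} {x : Icc a b}
    (h : IsLocalMin (f^[κ]) (f^[μ] x)) : IsLocalMin (f^[κ + μ]) x := by
  rw [Function.iterate_add]
  exact IsMinFilter.comp_tendsto h ((hf.continuous.iterate μ).tendsto x)

theorem isLocalMax_iterate_add (hf : IsMultimodal f c) {κ μ : ℕ} {x : Icc a b}
    (h : IsLocalMax (f^[κ]) (f^[μ] x)) : IsLocalMax (f^[κ + μ]) x := by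
  rw [Function.iterate_add]
  exact IsMaxFilter.comp_tendsto h ((hf.continuous.iterate μ).tendsto x)

theorem isLocalExtr_of_mem_hitSet (hf : IsMultimodal f c) {ν : ℕ} {x : Icc a b}
    (hx : x ∈ hitSet f c ν) : IsLocalExtr (f^[ν]) x := by
  obtain ⟨μ, hμ, k, hk⟩ := hx
  obtain ⟨κ, rfl⟩ : ∃ κ, ν = κ + 1 + μ := ⟨ν - μ - 1, by omega⟩
  have h := hf.isLocalExtr_iterate κ k
  rw [hk] at h
  exact h.imp hf.isLocalMin_iterate_add hf.isLocalMax_iterate_add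

theorem crossesAt_of_notMem_hitSet (hf : IsMultimodal f c) {ν : ℕ} {x : Icc a b}
    (hxI : (x : ℝ) ∈ Ioo a b) (hx : x ∉ hitSet f c ν) : CrossesAt (f^[ν]) x := by
  have hab : a ≤ b := (hxI.1.trans hxI.2).le
  have hT : (hitSet f c ν)ᶜ ∈ 𝓝 x := (hf.finite_hitSet ν).isClosed.isOpen_compl.mem_nhds hx
  obtain ⟨u, v, ⟨hu, hv⟩, hsub⟩ := (mem_nhds_iff_exists_Ioo_subset'
    ⟨⟨a, left_mem_Icc.2 hab⟩, hxI.1⟩ ⟨⟨b, right_mem_Icc.2 hab⟩, hxI.2⟩).1 hT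
  have hxuv : x ∈ Icc u v := ⟨hu.le, hv.le⟩
  rcases hf.strict_on_Icc_iterate ν fun z hz => hsub hz with h | h
  · left
    constructor
    · filter_upwards [Ioo_mem_nhdsLT hu] with z hz
      exact h ⟨hz.1.le, hz.2.le.trans hv.le⟩ hxuv hz.2
    · filter_upwards [Ioo_mem_nhdsGT hv] with z hz
      exact h hxuv ⟨hu.le.trans hz.1.le, hz.2.le⟩ hz.1
  · right
    constructor
    · filter_upwards [Ioo_mem_nhdsLT hu] with z hz
      exact h ⟨hz.1.le, hz.2.le.trans hv.le⟩ hxuv hz.2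
    · filter_upwards [Ioo_mem_nhdsGT hv] with z hz
      exact h hxuv ⟨hu.le.trans hz.1.le, hz.2.le⟩ hz.1

/-- The definition of s_ν^i forbids earlier visits to c_i only, but transversality forbids earlier
visits to every turning point, since these make f^ν extremal. Without such visits f^ν is strictly
monotone near x, hence transversal. -/
theorem crossCount_eq (hf : IsMultimodal f c) (ν : ℕ) (i : Fin l) :
    crossCount f c ν i = (firstHit f c ν i).ncard := by
  unfold crossCount firstHit
  congr 1
  ext x
  constructor
  · rintro ⟨hI, hx, -, hcr⟩
    exact ⟨hI, hx, fun h => not_crossesAt_of_isLocalExtr hI (hf.isLocalExtr_of_mem_hitSet h) hcr⟩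
  · rintro ⟨hI, hx, hn⟩
    exact ⟨hI, hx, fun μ hμ h => hn ⟨μ, hμ, i, h.symm⟩, hf.crossesAt_of_notMem_hitSet hI hn⟩

theorem finite_firstHit (hf : IsMultimodal f c) (ν : ℕ) (i : Fin l) :
    (firstHit f c ν i).Finite :=
  (hf.finite_fiber ν (c i)).subset fun _ hx => hx.2.1

theorem crossCount_le (hf : IsMultimodal f c) (ν : ℕ) (i : Fin l) :
    crossCount f c ν i ≤ (hitSet f c ν).ncard + 1 := by
  rw [hf.crossCount_eq]
  exact (ncard_le_ncard (fun _ hx => hx.2.1) (hf.finite_fiber ν (c i))).trans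
    (hf.ncard_fiber_le ν (c i))

theorem badSum_le (hf : IsMultimodal f c) (ν : ℕ) (i : Fin l) :
    badSum f c ν i ≤ 2 * (l * ν * ((hitSet f c ν).ncard + 1)) := by
  classical
  refine Nat.mul_le_mul_left 2 ?_
  refine (Finset.sum_le_card_nsmul _ _ ((hitSet f c ν).ncard + 1) fun p _ => ?_).trans ?_
  · exact (hf.crossCount_le _ _).trans
      (Nat.succ_le_succ (hf.ncard_hitSet_mono (Nat.sub_le _ _)))
  · rw [smul_eq_mul]
    refine Nat.mul_le_mul_right _ ((Finset.card_filter_le _ _).trans ?_)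
    simp

/-- If the orbit of x first meets the turning points at time μ, in c_k, then x inherits the value
and the type of extremum of f^{ν-μ} at c_k, so the symbol ω_{ν-μ}^k decides. -/
theorem lt_or_gt_of_good (hf : IsMultimodal f c) {ν : ℕ} {i : Fin l} {x : Icc a b}
    (hxI : (x : ℝ) ∈ Ioo a b) (hx : x ∈ hitSet f c ν)
    (hgood : ∀ p ∈ badIndices f c ν i, x ∉ firstHit f c (ν - p.2) p.1) :
    (IsLocalMin (f^[ν]) x ∧ f^[ν] x < c i) ∨ (IsLocalMax (f^[ν]) x ∧ c i < f^[ν] x) := by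
  classical
  have hex : ∃ μ, f^[μ] x ∈ range c := hx.imp fun μ h => h.2
  obtain ⟨k, hk⟩ := Nat.find_spec hex
  have hmin : x ∉ hitSet f c (Nat.find hex) := fun ⟨μ, hμ, h⟩ => Nat.find_min hex hμ h
  have hlt : Nat.find hex < ν := by
    obtain ⟨μ, hμ, h⟩ := hx
    exact (Nat.find_min' hex h).trans_lt hμ
  generalize Nat.find hex = μ at *
  obtain ⟨κ, rfl⟩ : ∃ κ, ν = κ + 1 + μ := ⟨ν - μ - 1, by omega⟩
  have hfirst : x ∈ firstHit f c (κ + 1 + μ - (κ + 1)) k := by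
    rw [Nat.add_sub_cancel_left]
    exact ⟨hxI, hk.symm, hmin⟩
  have hnot : minMaxSymbol f c (κ + 1) k ∉ badSymbols i := fun hbad =>
    hgood (k, κ + 1) (by simp [badIndices, hbad]) hfirst
  have hval : f^[κ + 1 + μ] x = f^[κ + 1] (c k) := by
    rw [hk, ← Function.iterate_add_apply]
  rw [hval]
  rcases lt_or_gt_of_minMaxSymbol_notMem hf.strictMono hnot with ⟨h1, h2⟩ | ⟨h1, h2⟩
  · rw [hk] at h1
    exact .inl ⟨hf.isLocalMin_iterate_add h1, h2⟩
  · have h3 := (hf.isLocalExtr_iterate κ k).resolve_left h1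
    rw [hk] at h3
    exact .inr ⟨hf.isLocalMax_iterate_add h3, h2⟩

/-- Between two consecutive good turning points of `f^ν` there is a crossing. -/
theorem exists_firstHit_of_good (hf : IsMultimodal f c) {ν : ℕ} {i : Fin l} {p q : Icc a b}
    (hpq : p < q) (hcon : ∀ z ∈ Ioo p q, z ∉ hitSet f c ν)
    (hp : (IsLocalMin (f^[ν]) p ∧ f^[ν] p < c i) ∨ (IsLocalMax (f^[ν]) p ∧ c i < f^[ν] p))
    (hq : (IsLocalMin (f^[ν]) q ∧ f^[ν] q < c i) ∨ (IsLocalMax (f^[ν]) q ∧ c i < f^[ν] q)) :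
    ∃ t ∈ Ioo p q, t ∈ firstHit f c ν i := by
  have hcases : c i ∈ uIcc (f^[ν] p) (f^[ν] q) ∧ f^[ν] p ≠ c i ∧ f^[ν] q ≠ c i := by
    -- An increasing branch cannot start at a maximum or end at a minimum, so it rises from a
    -- minimum below the line to a maximum above it. A decreasing branch is symmetric.
    rcases hf.strict_on_Icc_iterate ν hcon with h | h
    · obtain ⟨-, h1⟩ := hp.resolve_right fun h' => h.not_isLocalMax_left hpq h'.1
      obtain ⟨-, h2⟩ := hq.resolve_left fun h' => h.not_isLocalMin_right hpq h'.1
      exact ⟨Icc_subset_uIcc ⟨h1.le, h2.le⟩, h1.ne, h2.ne'⟩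
    · obtain ⟨-, h1⟩ := hp.resolve_left fun h' => h.not_isLocalMin_left hpq h'.1
      obtain ⟨-, h2⟩ := hq.resolve_right fun h' => h.not_isLocalMax_right hpq h'.1
      exact ⟨Icc_subset_uIcc' ⟨h2.le, h1.le⟩, h1.ne', h2.ne⟩
  obtain ⟨hmem, h1, h2⟩ := hcases
  obtain ⟨t, ht, hte⟩ := exists_mem_Icc_apply_eq (hf.continuous.iterate ν) hpq.le hmem
  have htI : t ∈ Ioo p q := ⟨lt_of_le_of_ne ht.1 fun e => h1 (e ▸ hte),
    lt_of_le_of_ne ht.2 fun e => h2 (e ▸ hte)⟩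
  exact ⟨t, htI, ⟨p.2.1.trans_lt (Subtype.coe_lt_coe.2 htI.1),
    (Subtype.coe_lt_coe.2 htI.2).trans_le q.2.2⟩, hte, hcon t htI⟩

/-- With T the interior hitting points and B the bad ones, two points of T \ B are separated by a
bad point or a crossing. So |T \ B| ≤ |B| + s_ν^i + 1 and |T| ≤ 2|B| + s_ν^i + 1. The endpoints a
and b may also hit turning points, which raises 1 to 3. -/
theorem ncard_hitSet_le (hf : IsMultimodal f c) (ν : ℕ) (i : Fin l) :
    (hitSet f c ν).ncard ≤ crossCount f c ν i + badSum f c ν i + 3 := by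
  set T := hitSet f c ν ∩ {x | (x : ℝ) ∈ Ioo a b} with hTdef
  set B := ⋃ p ∈ badIndices f c ν i, firstHit f c (ν - p.2) p.1 with hBdef
  have hTfin : T.Finite := (hf.finite_hitSet ν).inter_of_left _
  have hBfin : B.Finite :=
    (badIndices f c ν i).finite_toSet.biUnion fun p _ => hf.finite_firstHit _ _
  have hBcard : 2 * B.ncard ≤ badSum f c ν i := by
    refine Nat.mul_le_mul_left 2 ((Finset.set_ncard_biUnion_le _ _).trans_eq ?_)
    exact Finset.sum_congr rfl fun p _ => (hf.crossCount_eq _ _).symm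
  have hT : (hitSet f c ν).ncard ≤ T.ncard + 2 := by
    refine (ncard_le_ncard (t := T ∪ {x : Icc a b | (x : ℝ) ∉ Ioo a b}) ?_
      (hTfin.union (finite_endpoints a b))).trans
      ((ncard_union_le _ _).trans (Nat.add_le_add_left (ncard_endpoints_le a b) _))
    intro x hx
    by_cases h : (x : ℝ) ∈ Ioo a b
    exacts [.inl ⟨hx, h⟩, .inr h]
  have hgood : ∀ x ∈ T, x ∉ B → (IsLocalMin (f^[ν]) x ∧ f^[ν] x < c i) ∨
      (IsLocalMax (f^[ν]) x ∧ c i < f^[ν] x) := fun x hx hxB =>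
    hf.lt_or_gt_of_good hx.2 hx.1 fun p hp hxp => hxB (mem_biUnion (x := p) hp hxp)
  have hG : (T \ B).ncard ≤ (B ∪ firstHit f c ν i).ncard + 1 := by
    refine (ncard_le_of_separated (hBfin.union (hf.finite_firstHit ν i)) ?_).2
    intro p hp q hq hpq
    by_contra! hcon
    -- r is the next point of T after p. It is not bad, since no bad point lies in [p, q) and q
    -- itself is not bad, so p and r are adjacent good extrema.
    obtain ⟨r, ⟨hrT, hpr, hrq⟩, hrmin⟩ := exists_min_image (T ∩ Ioc p q) id
      (hTfin.inter_of_left _) ⟨q, hq.1, hpq, le_rfl⟩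
    have hrB : r ∉ B := by
      rcases hrq.lt_or_eq with h | h
      · exact fun hr => absurd h (not_lt.2 (hcon r (.inl hr) hpr.le))
      · exact h ▸ hq.2
    obtain ⟨t, ht, hth⟩ := hf.exists_firstHit_of_good hpr (fun z hz hzn => by
      have hzI : (z : ℝ) ∈ Ioo a b := ⟨p.2.1.trans_lt (Subtype.coe_lt_coe.2 hz.1),
        (Subtype.coe_lt_coe.2 hz.2).trans_le r.2.2⟩
      exact absurd hz.2 (not_lt.2 (hrmin z ⟨⟨hzn, hzI⟩, hz.1, hz.2.le.trans hrq⟩)))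
      (hgood p hp.1 hp.2) (hgood r hrT hrB)
    exact absurd (ht.2.trans_le hrq) (not_lt.2 (hcon t (.inr hth) ht.1.le))
  have h1 := ncard_union_le B (firstHit f c ν i)
  have h2 := ncard_le_ncard_sdiff_add_ncard T B hBfin
  rw [hf.crossCount_eq]
  omega

end IsMultimodal

/-! ### Comparison of the growth rates -/

theorem Real.log_natCast_div_ge {N l t : ℕ} (hl : 1 ≤ l) (h : t ≤ N + 3) :
    Real.log ((t : ℝ) + 1) - Real.log (5 * l) ≤ Real.log ((N : ℝ) / l) := by
  have hl' : (1 : ℝ) ≤ l := by exact_mod_cast hl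
  have h' : (t : ℝ) ≤ N + 3 := by exact_mod_cast h
  -- For N = 0 the convention log 0 = 0 applies and t + 1 ≤ 4 ≤ 5l. For N ≥ 1, t + 1 ≤ N + 4 ≤ 5N,
  -- which explains the constant 5.
  rcases Nat.eq_zero_or_pos N with rfl | hN
  · simp only [Nat.cast_zero, zero_div, Real.log_zero, sub_nonpos] at h' ⊢
    exact Real.log_le_log (by positivity) (by linarith)
  · have hN' : (1 : ℝ) ≤ N := by exact_mod_cast hN
    rw [← Real.log_div (by positivity) (by positivity)]
    refine Real.log_le_log (by positivity) ?_
    rw [div_le_div_iff₀ (by positivity) (by positivity)]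
    nlinarith

theorem Real.log_natCast_div_le {N l C : ℕ} (hl : 1 ≤ l) (h : N ≤ C) :
    Real.log ((N : ℝ) / l) ≤ Real.log C := by
  have hl' : (1 : ℝ) ≤ l := by exact_mod_cast hl
  rcases Nat.eq_zero_or_pos N with rfl | hN
  · simpa using Real.log_natCast_nonneg C
  · have hN' : (1 : ℝ) ≤ N := by exact_mod_cast hN
    refine Real.log_le_log (by positivity) ((div_le_self (by positivity) hl').trans ?_)
    exact_mod_cast h

namespace IsMultimodal

variable {a b : ℝ} {l : ℕ} {f : Icc a b → Icc a b} {c : Fin l → Icc a b}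

theorem totalCount_ge (hf : IsMultimodal f c) (hl : 1 ≤ l) (ν : ℕ) :
    (hitSet f c ν).ncard ≤ totalCrossCount f c ν + totalBadSum f c ν + 3 := by
  have i : Fin l := ⟨0, hl⟩
  have h1 : crossCount f c ν i ≤ totalCrossCount f c ν :=
    Finset.single_le_sum (f := crossCount f c ν) (fun _ _ => Nat.zero_le _) (Finset.mem_univ i)
  have h2 : badSum f c ν i ≤ totalBadSum f c ν :=
    Finset.single_le_sum (f := badSum f c ν) (fun _ _ => Nat.zero_le _) (Finset.mem_univ i)
  have := hf.ncard_hitSet_le ν i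
  omega

theorem totalCount_le (hf : IsMultimodal f c) (ν : ℕ) :
    totalCrossCount f c ν + totalBadSum f c ν ≤
      (l + 1) * ((ν * (2 * l) + 1) * ((hitSet f c ν).ncard + 1)) := by
  have h1 : totalCrossCount f c ν ≤ l * ((hitSet f c ν).ncard + 1) := by
    simpa [totalCrossCount] using
      Finset.sum_le_card_nsmul Finset.univ _ _ fun i _ => hf.crossCount_le ν i
  have h2 : totalBadSum f c ν ≤ l * (2 * (l * ν * ((hitSet f c ν).ncard + 1))) := by
    simpa [totalBadSum] using
      Finset.sum_le_card_nsmul Finset.univ _ _ fun i _ => hf.badSum_le ν i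
  calc _ ≤ l * ((ν * (2 * l) + 1) * ((hitSet f c ν).ncard + 1)) := by
        refine (Nat.add_le_add h1 h2).trans_eq ?_
        ring
    -- The factor l + 1 is positive for every l, which is convenient when the logarithm of the
    -- product is split.
    _ ≤ _ := Nat.mul_le_mul_right _ l.le_succ

theorem tendsto_log_totalCount (hf : IsMultimodal f c) (hl : 1 ≤ l) {L : ℝ}
    (hL : Tendsto (fun n : ℕ => Real.log ((hitSet f c n).ncard + 1) / n) atTop (𝓝 L)) :
    Tendsto (fun ν : ℕ => 1 / (ν : ℝ) *
      Real.log (((totalCrossCount f c ν : ℝ) + totalBadSum f c ν) / l)) atTop (𝓝 L) := by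
  have hlow : Tendsto (fun ν : ℕ => (Real.log ((hitSet f c ν).ncard + 1) - Real.log (5 * l)) / ν)
      atTop (𝓝 L) := by
    have := hL.sub ((tendsto_const_nhds (x := Real.log (5 * l))).div_atTop
      (tendsto_natCast_atTop_atTop (R := ℝ)))
    rw [sub_zero] at this
    exact this.congr fun ν => (sub_div _ _ _).symm
  have hup : Tendsto (fun ν : ℕ => (Real.log (l + 1) + (Real.log ((ν : ℝ) * (2 * l : ℕ) + 1) +
      Real.log ((hitSet f c ν).ncard + 1))) / ν) atTop (𝓝 L) := by
    have := ((tendsto_const_nhds (x := Real.log (l + 1))).div_atTop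
      (tendsto_natCast_atTop_atTop (R := ℝ))).add ((tendsto_log_mul_add_one_div (2 * l)).add hL)
    rw [zero_add, zero_add] at this
    exact this.congr fun ν => by rw [add_div, add_div]
  refine tendsto_of_tendsto_of_tendsto_of_le_of_le hlow hup (fun ν => ?_) (fun ν => ?_)
  · simp only [one_div_mul_eq_div]
    refine div_le_div_of_nonneg_right ?_ ν.cast_nonneg
    exact_mod_cast Real.log_natCast_div_ge hl (hf.totalCount_ge hl ν)
  · simp only [one_div_mul_eq_div]
    refine div_le_div_of_nonneg_right ?_ ν.cast_nonneg
    rw [← Real.log_mul (by positivity) (by positivity),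
      ← Real.log_mul (by positivity) (by positivity)]
    exact_mod_cast Real.log_natCast_div_le hl (hf.totalCount_le ν)

end IsMultimodal

theorem theorem4 {a b : ℝ} {l : ℕ} (hl : 1 ≤ l) (f : Set.Icc a b → Set.Icc a b)
    (c : Fin l → Set.Icc a b) (hf : IsMultimodal f c) :
    Tendsto (fun ν : ℕ =>
        (((1 / (ν : ℝ)) * Real.log
          (((totalCrossCount f c ν : ℝ) + (totalBadSum f c ν : ℝ)) / (l : ℝ)) : ℝ) : EReal))
      atTop (𝓝 (Dynamics.coverEntropy f Set.univ)) ∧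
    Tendsto (fun ν : ℕ =>
        (((1 / (ν : ℝ)) * Real.log
          ((1 / (l : ℝ)) * ∑ i : Fin l, ((crossCount f c ν i : ℝ) +
            2 * ∑ p ∈ badIndices f c ν i, (crossCount f c (ν - p.2) p.1 : ℝ))) : ℝ) : EReal))
      atTop (𝓝 (Dynamics.coverEntropy f Set.univ)) := by
  have : Nonempty (Icc a b) := ⟨c ⟨0, hl⟩⟩
  obtain ⟨L, hL, hent⟩ := hf.tendsto_log_ncard_hitSet
  have hreal := (continuous_coe_real_ereal.tendsto L).comp (hf.tendsto_log_totalCount hl hL)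
  rw [hent]
  refine ⟨hreal, hreal.congr fun ν => ?_⟩
  simp only [Function.comp_apply, totalCrossCount, totalBadSum, badSum, Nat.cast_sum, Nat.cast_mul,
    Nat.cast_ofNat, Finset.sum_add_distrib, one_div_mul_eq_div]
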